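/- Let $d\ge 1$, let $G_1,\dots,G_d$ be finite groups of orders $k_1,\dots,k_d$, and let $k$ be an algebraically closed field whose characteristic is either $0$ or relatively prime to $\prod_{i=1}^d |G_i|$. A $k_i\times k_i$ matrix $C=(c_{g,h})_{g,h\in G_i}$ over $k$ with rows and columns indexed by $G_i$ is called $G_i$-circulant if $c_{xg,xh}=c_{g,h}$ for all $x,g,h\in G_i$. Let $\mathcal{J}_{G_1,\dots,G_d}(k)$ be the subalgebra of $M_{k_1+\cdots+k_d}(k)$ consisting of all block matrices $$\begin{bmatrix} C_1 & a_{12}J_{k_1,k_2} & \cdots & a_{1d}J_{k_1,k_d}\\ a_{21}J_{k_2,k_1} & C_2 & \cdots & a_{2d}J_{k_2,k_d}\\ \vdots & \vdots & \ddots & \vdots\\ a_{d1}J_{k_d,k_1} & a_{d2}J_{k_d,k_2} & \cdots & C_d\end{bmatrix},$$ where each $C_i$ is a $G_i$-circulant matrix over $k$, $a_{ij}\in k$ for $i\ne j$, and $J_{r,s}$ is the $r\times s$ matrix with all entries equal to $1$. Then the number of irreducible (that is, simple) left modules over $\mathcal{J}_{G_1,\dots,G_d}(k)$, counted up to isomorphism,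 is finite and equal to $$c(G_1)+c(G_2)+\cdots+c(G_d)-d+1,$$ where $c(G_i)$ is the number of conjugacy classes of $G_i$. -/

import Mathlib

universe u v

/-- A square matrix `A` with rows and columns indexed by a group `G` is `G`-circulant if
`A (g * x) (g * y) = A x y` for all `g, x, y`. -/
def IsGCirculant {R : Type u} {G : Type v} [Group G] (A : Matrix G G R) : Prop :=
  ∀ g x y : G, A (g * x) (g * y) = A x y

/-- A block matrix, with `i`-th block of rows (and of columns) indexed by `G i`, is a join of
circulant matrices if every diagonal block is `G i`-circulant and every off-diagonal block is a
scalar multiple of the all-ones matrix. -/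
def IsCirculantJoin {R : Type u} {d : ℕ} {G : Fin d → Type v} [∀ i, Group (G i)]
    (A : Matrix (Σ i, G i) (Σ i, G i) R) : Prop :=
  (∀ i, IsGCirculant (fun x y : G i => A ⟨i, x⟩ ⟨i, y⟩)) ∧
    ∀ i j, i ≠ j → ∃ a : R, ∀ (x : G i) (y : G j), A ⟨i, x⟩ ⟨j, y⟩ = a

theorem isCirculantJoin_iff {R : Type u} {d : ℕ} {G : Fin d → Type v} [∀ i, Group (G i)]
    (A : Matrix (Σ i, G i) (Σ i, G i) R) :
    IsCirculantJoin A ↔ ∀ (g : ∀ i, G i) (i j : Fin d) (x : G i) (y : G j),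
      A ⟨i, g i * x⟩ ⟨j, g j * y⟩ = A ⟨i, x⟩ ⟨j, y⟩ := by
  constructor
  · rintro ⟨h1, h2⟩ g i j x y
    by_cases hij : i = j
    · subst hij
      exact h1 i (g i) x y
    · obtain ⟨a, ha⟩ := h2 i j hij
      rw [ha, ha]
  · intro h
    refine ⟨fun i g x y => ?_, fun i j hij => ⟨A ⟨i, 1⟩ ⟨j, 1⟩, fun x y => ?_⟩⟩
    · have := h (Function.update (fun _ => 1) i g) i i x y
      simpa using this
    · have := h (Function.update (Function.update (fun _ => 1) i x) j y) i j 1 1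
      simpa [Function.update_of_ne hij] using this

/-- The join algebra `𝒥_{G₁,…,G_d}(R)`: the subalgebra of all joins of circulant matrices in the
matrix algebra of size `∑ |G i|`. -/
def joinAlgebra (R : Type u) [CommRing R] {d : ℕ} (G : Fin d → Type v) [∀ i, Group (G i)]
    [∀ i, Fintype (G i)] [∀ i, DecidableEq (G i)] :
    Subalgebra R (Matrix (Σ i, G i) (Σ i, G i) R) where
  carrier := {A | IsCirculantJoin A}
  mul_mem' := by
    intro A B hA hB
    simp only [Set.mem_ofPred_eq, isCirculantJoin_iff] at hA hB ⊢
    intro g i j x y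
    rw [Matrix.mul_apply, Matrix.mul_apply,
      ← Equiv.sum_comp (Equiv.sigmaCongrRight fun i => Equiv.mulLeft (g i))]
    refine Finset.sum_congr rfl fun z _ => ?_
    exact congrArg₂ (· * ·) (hA g i z.1 x z.2) (hB g z.1 j z.2 y)
  add_mem' := by
    intro A B hA hB
    simp only [Set.mem_ofPred_eq, isCirculantJoin_iff] at hA hB ⊢
    intro g i j x y
    simp only [Matrix.add_apply, hA, hB]
  algebraMap_mem' := by
    intro r
    simp only [Set.mem_ofPred_eq, isCirculantJoin_iff]
    intro g i j x y
    simp only [Matrix.algebraMap_matrix_apply]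
    by_cases hij : i = j
    · subst hij
      simp
    · simp [hij]

/-- Isomorphism of simple left modules. Taking modules in the universe of the ring loses nothing:
every simple `R`-module is isomorphic to a quotient of `R`. -/
def simpleModuleSetoid (R : Type u) [Ring R] :
    Setoid {M : ModuleCat.{u} R // IsSimpleModule R M} where
  r M N := Nonempty (M.1 ≃ₗ[R] N.1)
  iseqv :=
    { refl := fun M => ⟨LinearEquiv.refl R M.1⟩
      symm := fun ⟨e⟩ => ⟨e.symm⟩
      trans := fun ⟨e⟩ ⟨f⟩ => ⟨e.trans f⟩ }

/-- The isomorphism classes of simple (irreducible) left modules over a ring. -/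
def SimpleModuleClasses (R : Type u) [Ring R] : Type (u + 1) :=
  Quotient (simpleModuleSetoid R)

/-! The join algebra is the commutant of `∏ i, G i` permuting the basis of `(Σ i, G i) → k`:
independent translations in two different blocks force the off-diagonal block to be constant. By
Maschke the representation is semisimple, hence so is the algebra (`isSemisimpleRing_joinAlgebra`).
Over an algebraically closed field, simple modules are then counted by the dimension of the center
(`card_simpleModuleClasses`). A central element is block diagonal with class functions as blocks,
and commuting with the off-diagonal all-ones blocks forces these class functions to have equal sums
(`map_center_joinAlgebra`). Equality of `d` sums is `d - 1` independent conditions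
(`finrank_equalClassSum`). -/

/-! ### Counting simple modules by the center -/

theorem isotypicComponent_mem_isotypicComponents (R M S : Type*) [Ring R] [AddCommGroup M]
    [Module R M] [AddCommGroup S] [Module R S] [IsSimpleModule R S] (N : Submodule R M)
    (e : S ≃ₗ[R] N) : isotypicComponent R M S ∈ isotypicComponents R M :=
  ⟨N, IsSimpleModule.congr e.symm, e.isotypicComponent_eq⟩

/-- Over a semisimple ring, two simple modules with the same isotypic component in the regular
module are isomorphic. -/
theorem nonempty_linearEquiv_of_isotypicComponent_eq (R S T : Type*) [Ring R] [IsSemisimpleRing R]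
    [AddCommGroup S] [Module R S] [AddCommGroup T] [Module R T] [IsSimpleModule R S]
    [IsSimpleModule R T] (h : isotypicComponent R R S = isotypicComponent R R T) :
    Nonempty (S ≃ₗ[R] T) := by
  obtain ⟨I, ⟨e⟩⟩ := IsSemisimpleRing.exists_linearEquiv_ideal_of_isSimpleModule R S
  have := IsSimpleModule.congr e.symm
  have hle : I ≤ isotypicComponent R R T :=
    I.le_isotypicComponent.trans_eq (e.symm.isotypicComponent_eq.trans h)
  obtain ⟨e'⟩ := isIsotypicOfType_submodule_iff.mp (.isotypicComponent R R T) I hle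
  exact ⟨e.trans e'⟩

/-- Isomorphism classes of simple modules over a semisimple ring correspond to the isotypic
components of the regular module. -/
noncomputable def simpleModuleClassesEquiv (R : Type u) [Ring R] [IsSemisimpleRing R] :
    SimpleModuleClasses R ≃ isotypicComponents R R :=
  Equiv.ofBijective
    (Quotient.lift
      (fun M : {M : ModuleCat.{u} R // IsSimpleModule R M} =>
        (⟨isotypicComponent R R M.1, by
          have := M.2
          obtain ⟨I, ⟨e⟩⟩ := IsSemisimpleRing.exists_linearEquiv_ideal_of_isSimpleModule R M.1
          exact isotypicComponent_mem_isotypicComponents R R M.1 I e⟩ : isotypicComponents R R))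
      (by
        rintro M N ⟨e⟩
        exact Subtype.ext e.isotypicComponent_eq))
    (by
      constructor
      · intro a b
        refine Quotient.inductionOn₂ a b fun M N h => Quotient.sound ?_
        have := M.2
        have := N.2
        exact nonempty_linearEquiv_of_isotypicComponent_eq R M.1 N.1 (congrArg Subtype.val h)
      · rintro ⟨_, S, hS, rfl⟩
        exact ⟨Quotient.mk _ ⟨ModuleCat.of R S, hS⟩, rfl⟩)

/-- The center is invariant under algebra isomorphisms. -/
theorem AlgEquiv.finrank_center_eq {k A B : Type*} [Field k] [Ring A] [Algebra k A] [Ring B]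
    [Algebra k B] (e : A ≃ₐ[k] B) :
    Module.finrank k (Subalgebra.center k A) = Module.finrank k (Subalgebra.center k B) := by
  have h : (Subalgebra.toSubmodule (Subalgebra.center k A)).map (e.toLinearEquiv : A →ₗ[k] B) =
      Subalgebra.toSubmodule (Subalgebra.center k B) := by
    ext b
    simp only [Submodule.mem_map, Subalgebra.mem_toSubmodule, Subalgebra.mem_center_iff]
    constructor
    · rintro ⟨a, ha, rfl⟩ c
      simpa using congrArg e (ha (e.symm c))
    · intro hb
      refine ⟨e.symm b, fun c => ?_, by simp⟩
      simpa using congrArg e.symm (hb (e c))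
  change Module.finrank k (Subalgebra.toSubmodule (Subalgebra.center k A)) =
    Module.finrank k (Subalgebra.toSubmodule (Subalgebra.center k B))
  rw [← h]
  exact (e.toLinearEquiv.submoduleMap _).finrank_eq

/-- Needed because the endomorphism algebra of the left regular module is `Aᵐᵒᵖ`. -/
theorem finrank_center_mulOpposite (k A : Type*) [Field k] [Ring A] [Algebra k A] :
    Module.finrank k (Subalgebra.center k Aᵐᵒᵖ) = Module.finrank k (Subalgebra.center k A) := by
  have h : (Subalgebra.toSubmodule (Subalgebra.center k A)).map
      (MulOpposite.opLinearEquiv k : A ≃ₗ[k] Aᵐᵒᵖ).toLinearMap =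
      Subalgebra.toSubmodule (Subalgebra.center k Aᵐᵒᵖ) := by
    ext b
    simp only [Submodule.mem_map, Subalgebra.mem_toSubmodule, Subalgebra.mem_center_iff]
    constructor
    · rintro ⟨a, ha, rfl⟩ c
      exact MulOpposite.unop_injective (ha c.unop).symm
    · intro hb
      exact ⟨b.unop, fun c => MulOpposite.op_injective (hb (.op c)).symm, rfl⟩
  change Module.finrank k (Subalgebra.toSubmodule (Subalgebra.center k Aᵐᵒᵖ)) =
    Module.finrank k (Subalgebra.toSubmodule (Subalgebra.center k A))
  rw [← h]
  exact ((MulOpposite.opLinearEquiv k).submoduleMap _).finrank_eq.symm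

/-- The center of a finite product of nontrivial central algebras has dimension the number of
factors. -/
theorem finrank_center_pi {k ι : Type*} [Field k] [Finite ι] (A : ι → Type*) [∀ i, Ring (A i)]
    [∀ i, Algebra k (A i)] [∀ i, Nontrivial (A i)] [∀ i, Algebra.IsCentral k (A i)] :
    Module.finrank k (Subalgebra.center k (∀ i, A i)) = Nat.card ι := by
  have := Fintype.ofFinite ι
  let f : (ι → k) →ₗ[k] (∀ i, A i) := LinearMap.pi fun i => Algebra.linearMap k (A i) ∘ₗ .proj i
  have hf : Function.Injective f := fun a b h => funext fun i =>
    FaithfulSMul.algebraMap_injective k (A i) (congrFun h i)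
  have h : LinearMap.range f = Subalgebra.toSubmodule (Subalgebra.center k (∀ i, A i)) := by
    ext x
    simp only [Subalgebra.center_pi, LinearMap.mem_range, Subalgebra.mem_toSubmodule,
      Subalgebra.mem_pi, Set.mem_univ, true_imp_iff, Algebra.IsCentral.mem_center_iff]
    constructor
    · rintro ⟨a, rfl⟩ i
      exact ⟨a i, rfl⟩
    · intro hx
      choose a ha using hx
      exact ⟨a, funext fun i => (ha i).symm⟩
  change Module.finrank k (Subalgebra.toSubmodule (Subalgebra.center k (∀ i, A i))) = _
  rw [← h, LinearMap.finrank_range_of_inj hf, Module.finrank_fintype_fun_eq_card,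
    Nat.card_eq_fintype_card]

/-- The endomorphism algebra of a nonzero isotypic module of finite length is central, when the
ground field is algebraically closed. -/
theorem IsIsotypic.isCentral_end (k : Type*) {A M : Type*} [Field k] [IsAlgClosed k] [Ring A]
    [Algebra k A] [AddCommGroup M] [Module A M] [Module k M] [IsScalarTower k A M]
    [FiniteDimensional k M] [IsSemisimpleModule A M] [Nontrivial M] [Module.Finite A M]
    (h : IsIsotypic A M) : Algebra.IsCentral k (Module.End A M) := by
  obtain ⟨n, hn, S, hS, ⟨e⟩⟩ := h.linearEquiv_fun
  classical
  have : FiniteDimensional k S := inferInstanceAs (FiniteDimensional k (S.restrictScalars k))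
  -- Schur's lemma: as `M ≅ Sⁿ`, its endomorphisms form a matrix algebra over `k`.
  have hb : Function.Bijective (algebraMap k (Module.End A S)) :=
    IsSimpleModule.algebraMap_end_bijective_of_isAlgClosed k
  have : Algebra.IsCentral k (Module.End A S) := by
    refine ⟨fun x _ => ?_⟩
    obtain ⟨a, rfl⟩ := hb.2 x
    exact Subalgebra.algebraMap_mem _ a
  exact Algebra.IsCentral.of_algEquiv k _ _
    ((e.conjAlgEquiv k).trans (endVecAlgEquivMatrixEnd (Fin n) k A S)).symm

/-- The center of a finite-dimensional semisimple algebra over an algebraically closed field has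
dimension the number of isotypic components of the regular module. -/
theorem finrank_center_eq_card_isotypicComponents (k A : Type*) [Field k] [IsAlgClosed k] [Ring A]
    [Algebra k A] [FiniteDimensional k A] [IsSemisimpleRing A] :
    Module.finrank k (Subalgebra.center k A) = Nat.card (isotypicComponents A A) := by
  classical
  have (c : isotypicComponents A A) : FiniteDimensional k c.1 :=
    inferInstanceAs (FiniteDimensional k (c.1.restrictScalars k))
  have (c : isotypicComponents A A) : Algebra.IsCentral k (Module.End A c.1) :=
    IsIsotypic.isCentral_end k (IsIsotypic.isotypicComponents c.2)
  rw [← finrank_center_mulOpposite,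
    ((AlgEquiv.moduleEndSelf k).trans (IsSemisimpleModule.endAlgEquiv k A A)).finrank_center_eq,
    finrank_center_pi]

theorem finite_simpleModuleClasses (R : Type u) [Ring R] [IsSemisimpleRing R] :
    Finite (SimpleModuleClasses R) :=
  .of_equiv _ (simpleModuleClassesEquiv R).symm

theorem card_simpleModuleClasses (k : Type*) (A : Type u) [Field k] [IsAlgClosed k] [Ring A]
    [Algebra k A] [FiniteDimensional k A] [IsSemisimpleRing A] :
    Nat.card (SimpleModuleClasses A) = Module.finrank k (Subalgebra.center k A) := by
  rw [finrank_center_eq_card_isotypicComponents, Nat.card_congr (simpleModuleClassesEquiv A)]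

/-! ### Semisimplicity of the join algebra -/

section Semisimple

variable (k : Type u) [Field k] {d : ℕ} (G : Fin d → Type v) [∀ i, Group (G i)]

/-- The permutation representation of `∏ i, G i` on functions on the disjoint union of the `G i`. -/
def sigmaRepresentation : Representation k (∀ i, G i) ((Σ i, G i) → k) where
  toFun g := LinearMap.funLeft k k fun x => ⟨x.1, (g x.1)⁻¹ * x.2⟩
  map_one' := by ext; simp
  map_mul' g h := by ext; simp [LinearMap.funLeft, mul_assoc]

theorem sigmaRepresentation_apply (g : ∀ i, G i) (f : (Σ i, G i) → k) (i : Fin d) (x : G i) :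
    sigmaRepresentation k G g f ⟨i, x⟩ = f ⟨i, (g i)⁻¹ * x⟩ := rfl

theorem sigmaRepresentation_single [∀ i, DecidableEq (G i)]
    (g : ∀ i, G i) (i : Fin d) (x : G i) (a : k) :
    sigmaRepresentation k G g (Pi.single ⟨i, x⟩ a) = Pi.single ⟨i, g i * x⟩ a := by
  ext ⟨j, y⟩
  rw [sigmaRepresentation_apply]
  by_cases hij : j = i
  · subst hij
    simp [Pi.single_apply, inv_mul_eq_iff_eq_mul]
  · simp [hij]

variable {k G} in
/-- A linear map with matrix a join of circulant matrices is the same as an equivariant map. -/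
theorem isCirculantJoin_toMatrix'_iff [∀ i, Fintype (G i)] [∀ i, DecidableEq (G i)]
    (f : ((Σ i, G i) → k) →ₗ[k] ((Σ i, G i) → k)) :
    IsCirculantJoin (LinearMap.toMatrix' f) ↔
      ∀ g v, f (sigmaRepresentation k G g v) = sigmaRepresentation k G g (f v) := by
  rw [isCirculantJoin_iff]
  constructor
  · intro h g v
    suffices f ∘ₗ sigmaRepresentation k G g = sigmaRepresentation k G g ∘ₗ f from
      LinearMap.congr_fun this v
    refine LinearMap.pi_ext' fun ⟨j, y⟩ => LinearMap.ext_ring (funext fun ⟨i, x⟩ => ?_)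
    have := h g i j ((g i)⁻¹ * x) y
    simpa [LinearMap.toMatrix'_apply, sigmaRepresentation_single, sigmaRepresentation_apply]
      using this
  · intro h g i j x y
    simp [LinearMap.toMatrix'_apply, ← sigmaRepresentation_single, h, sigmaRepresentation_apply]

/-- An equivariant endomorphism, as a linear endomorphism of the space of functions. -/
noncomputable def sigmaRepresentationEnd :
    Module.End (MonoidAlgebra k (∀ i, G i)) (sigmaRepresentation k G).asModule →+*
      Module.End k ((Σ i, G i) → k) :=
  (LinearEquiv.conjRingEquiv (sigmaRepresentation k G).asModuleEquiv).toRingHom.comp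
    { toFun := fun f => f.restrictScalars k
      map_one' := rfl
      map_mul' := fun _ _ => rfl
      map_zero' := rfl
      map_add' := fun _ _ => rfl }

theorem sigmaRepresentationEnd_apply
    (f : Module.End (MonoidAlgebra k (∀ i, G i)) (sigmaRepresentation k G).asModule)
    (v : (Σ i, G i) → k) :
    sigmaRepresentationEnd k G f v = (sigmaRepresentation k G).asModuleEquiv
      (f ((sigmaRepresentation k G).asModuleEquiv.symm v)) := rfl

theorem sigmaRepresentationEnd_comm
    (f : Module.End (MonoidAlgebra k (∀ i, G i)) (sigmaRepresentation k G).asModule)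
    (g : ∀ i, G i) (v : (Σ i, G i) → k) :
    sigmaRepresentationEnd k G f (sigmaRepresentation k G g v) =
      sigmaRepresentation k G g (sigmaRepresentationEnd k G f v) := by
  simp only [sigmaRepresentationEnd_apply]
  rw [Representation.asModuleEquiv_symm_map_rho, map_smul,
    Representation.asModuleEquiv_map_smul, Representation.asAlgebraHom_of]

variable [∀ i, Fintype (G i)] [∀ i, DecidableEq (G i)]

/-- The matrix of an equivariant endomorphism, as an element of the join algebra. -/
noncomputable def endToJoinAlgebra :
    Module.End (MonoidAlgebra k (∀ i, G i)) (sigmaRepresentation k G).asModule →+*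
      joinAlgebra k G :=
  ((LinearMap.toMatrixAlgEquiv' : _ ≃ₐ[k] _).toRingEquiv.toRingHom.comp
    (sigmaRepresentationEnd k G)).codRestrict (joinAlgebra k G) fun f =>
      (isCirculantJoin_toMatrix'_iff _).2 (sigmaRepresentationEnd_comm k G f)

theorem endToJoinAlgebra_surjective : Function.Surjective (endToJoinAlgebra k G) := by
  rintro ⟨A, hA⟩
  have h := (isCirculantJoin_toMatrix'_iff (Matrix.toLin' A)).1 (by
    rw [LinearMap.toMatrix'_toLin']
    exact hA)
  refine ⟨MonoidAlgebra.equivariantOfLinearOfComm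
    ((sigmaRepresentation k G).asModuleEquiv.symm.conj (Matrix.toLin' A)) fun g v => ?_, ?_⟩
  · obtain ⟨v, rfl⟩ := (sigmaRepresentation k G).asModuleEquiv.symm.surjective v
    rw [← MonoidAlgebra.of_apply, ← Representation.asModuleEquiv_symm_map_rho,
      LinearEquiv.conj_apply_apply, LinearEquiv.conj_apply_apply,
      ← Representation.asModuleEquiv_symm_map_rho]
    exact congrArg (sigmaRepresentation k G).asModuleEquiv.symm (h g v)
  · exact Subtype.ext (LinearMap.toMatrix'_toLin' A)

/-- The order of `∏ i, G i` is invertible, so Maschke applies. Endomorphism rings of finite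
semisimple modules are semisimple, and so are their quotients; surjectivity of `endToJoinAlgebra`
therefore suffices. -/
theorem isSemisimpleRing_joinAlgebra (hG : ∀ i, (Nat.card (G i) : k) ≠ 0) :
    IsSemisimpleRing (joinAlgebra k G) := by
  have : NeZero (Nat.card (∀ i, G i) : k) := ⟨by
    rw [Nat.card_pi, Nat.cast_prod]
    exact Finset.prod_ne_zero_iff.2 fun i _ => hG i⟩
  have : Module.Finite (MonoidAlgebra k (∀ i, G i)) (sigmaRepresentation k G).asModule :=
    .of_restrictScalars_finite k _ _
  have := IsSemisimpleRing.moduleEnd (MonoidAlgebra k (∀ i, G i)) (sigmaRepresentation k G).asModule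
  exact RingHom.isSemisimpleRing_of_surjective
    (R := Module.End (MonoidAlgebra k (∀ i, G i)) (sigmaRepresentation k G).asModule)
    (S := joinAlgebra k G) (endToJoinAlgebra k G) (endToJoinAlgebra_surjective k G)

end Semisimple

/-! ### The center of the join algebra and its dimension -/

theorem isCirculantJoin_of_fst {k : Type u} {d : ℕ} {G : Fin d → Type v} [∀ i, Group (G i)]
    (a : Fin d → Fin d → k) :
    IsCirculantJoin (Matrix.of fun x y : Σ i, G i => a x.1 y.1) :=
  ⟨fun _ _ _ _ => rfl, fun i j _ => ⟨a i j, fun _ _ => rfl⟩⟩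

section Center

variable (k : Type u) [Field k] {d : ℕ} (G : Fin d → Type v) [∀ i, Group (G i)]

/-- The block diagonal matrix whose `i`-th block is the circulant matrix of a class function. -/
def classCirculant : ((Σ i, ConjClasses (G i)) → k) →ₗ[k] Matrix (Σ i, G i) (Σ i, G i) k where
  toFun φ := Matrix.blockDiagonal' fun i => Matrix.of fun x y => φ ⟨i, ConjClasses.mk (x⁻¹ * y)⟩
  map_add' φ ψ := by
    rw [← Matrix.blockDiagonal'_add]
    rfl
  map_smul' c φ := by
    rw [RingHom.id_apply, ← Matrix.blockDiagonal'_smul]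
    rfl

section

variable {k G}

theorem classCirculant_apply_eq (φ : (Σ i, ConjClasses (G i)) → k) (i : Fin d) (x y : G i) :
    classCirculant k G φ ⟨i, x⟩ ⟨i, y⟩ = φ ⟨i, ConjClasses.mk (x⁻¹ * y)⟩ := by
  simp only [classCirculant, LinearMap.coe_mk, AddHom.coe_mk, Matrix.blockDiagonal'_apply_eq,
    Matrix.of_apply]

theorem classCirculant_apply_ne (φ : (Σ i, ConjClasses (G i)) → k) {i j : Fin d} (x : G i)
    (y : G j) (h : i ≠ j) : classCirculant k G φ ⟨i, x⟩ ⟨j, y⟩ = 0 := by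
  simp only [classCirculant, LinearMap.coe_mk, AddHom.coe_mk,
    Matrix.blockDiagonal'_apply_ne _ _ _ h]

theorem classCirculant_injective : Function.Injective (classCirculant k G) := by
  intro φ ψ h
  ext ⟨i, C⟩
  obtain ⟨g, rfl⟩ := ConjClasses.exists_rep C
  have := congrFun₂ h ⟨i, 1⟩ ⟨i, g⟩
  simpa only [classCirculant_apply_eq, inv_one, one_mul] using this

theorem isCirculantJoin_classCirculant (φ : (Σ i, ConjClasses (G i)) → k) :
    IsCirculantJoin (classCirculant k G φ) := by
  refine ⟨fun i g x y => ?_, fun i j h => ⟨0, fun x y => classCirculant_apply_ne φ x y h⟩⟩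
  simp only [classCirculant_apply_eq]
  congr 3
  group

variable [∀ i, DecidableEq (G i)]

theorem isCirculantJoin_diagonal_fst (a : Fin d → k) :
    IsCirculantJoin (Matrix.diagonal fun x : Σ i, G i => a x.1) := by
  refine ⟨fun i g x y => ?_, fun i j h => ⟨0, fun x y => ?_⟩⟩
  · simp [Matrix.diagonal_apply]
  · simp [h]

theorem isCirculantJoin_mulRight (g : ∀ i, G i) :
    IsCirculantJoin
      ((Equiv.sigmaCongrRight fun i => Equiv.mulRight (g i)).toPEquiv.toMatrix :
        Matrix (Σ i, G i) (Σ i, G i) k) := by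
  refine ⟨fun i h x y => ?_, fun i j h => ⟨0, fun x y => ?_⟩⟩
  · simp [PEquiv.toMatrix_apply, mul_assoc]
  · simp [PEquiv.toMatrix_apply, h]

end

variable [∀ i, Fintype (G i)]

/-- The sums of a family of class functions over the groups. -/
def classSum : ((Σ i, ConjClasses (G i)) → k) →ₗ[k] (Fin d → k) :=
  LinearMap.pi fun i => ∑ g : G i, LinearMap.proj ⟨i, ConjClasses.mk g⟩

theorem classSum_apply (φ : (Σ i, ConjClasses (G i)) → k) (i : Fin d) :
    classSum k G φ i = ∑ g : G i, φ ⟨i, ConjClasses.mk g⟩ := by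
  simp [classSum]

theorem classSum_surjective : Function.Surjective (classSum k G) := by
  classical
  intro c
  -- The class of `1` is a singleton, so no division by a class size is needed.
  refine ⟨fun C => if C.2 = ConjClasses.mk 1 then c C.1 else 0, funext fun i => ?_⟩
  simp [classSum_apply, ConjClasses.mk_eq_mk_iff_isConj]

/-- The families of class functions whose sums over the groups all agree. -/
def equalClassSum : Submodule k ((Σ i, ConjClasses (G i)) → k) :=
  (Submodule.span k {(1 : Fin d → k)}).comap (classSum k G)

theorem mem_equalClassSum_iff (φ : (Σ i, ConjClasses (G i)) → k) :
    φ ∈ equalClassSum k G ↔ ∃ c : k, ∀ i, ∑ g : G i, φ ⟨i, ConjClasses.mk g⟩ = c := by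
  simp only [equalClassSum, Submodule.mem_comap, Submodule.mem_span_singleton, funext_iff,
    classSum_apply, Pi.smul_apply, Pi.one_apply, smul_eq_mul, mul_one, eq_comm]

/-- This is the kernel of a surjection onto `k^d` modulo the all-ones line. That quotient has
dimension `d - 1` because `1 ≤ d` makes the all-ones vector nonzero. -/
theorem finrank_equalClassSum (hd : 1 ≤ d) :
    Module.finrank k (equalClassSum k G) + d = (∑ i, Nat.card (ConjClasses (G i))) + 1 := by
  classical
  have : ∀ i, Fintype (ConjClasses (G i)) := fun i => Fintype.ofFinite _
  have : NeZero d := ⟨by omega⟩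
  let T := (Submodule.span k {(1 : Fin d → k)}).mkQ ∘ₗ classSum k G
  have hT : LinearMap.ker T = equalClassSum k G := by
    rw [LinearMap.ker_comp, Submodule.ker_mkQ, equalClassSum]
  have hs : LinearMap.range T = ⊤ :=
    LinearMap.range_eq_top.2 ((Submodule.mkQ_surjective _).comp (classSum_surjective k G))
  have h1 := T.finrank_range_add_finrank_ker
  have h2 := Submodule.finrank_quotient_add_finrank (Submodule.span k {(1 : Fin d → k)})
  rw [finrank_span_singleton one_ne_zero, Module.finrank_fin_fun] at h2
  rw [hT, hs, finrank_top, Module.finrank_fintype_fun_eq_card, Fintype.card_sigma] at h1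
  simp only [Nat.card_eq_fintype_card]
  omega

variable {k G}

theorem commute_classCirculant {φ : (Σ i, ConjClasses (G i)) → k} (hφ : φ ∈ equalClassSum k G)
    {A : Matrix (Σ i, G i) (Σ i, G i) k} (hA : IsCirculantJoin A) :
    A * classCirculant k G φ = classCirculant k G φ * A := by
  obtain ⟨c, hc⟩ := (mem_equalClassSum_iff k G φ).1 hφ
  ext ⟨i, x⟩ ⟨j, y⟩
  have h1 : (A * classCirculant k G φ) ⟨i, x⟩ ⟨j, y⟩ =
      ∑ z : G j, A ⟨i, x⟩ ⟨j, z⟩ * φ ⟨j, ConjClasses.mk (z⁻¹ * y)⟩ := by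
    rw [Matrix.mul_apply, Fintype.sum_sigma, Fintype.sum_eq_single j fun l hl =>
      Finset.sum_eq_zero fun z _ => by rw [classCirculant_apply_ne φ z y hl, mul_zero]]
    simp only [classCirculant_apply_eq]
  have h2 : (classCirculant k G φ * A) ⟨i, x⟩ ⟨j, y⟩ =
      ∑ z : G i, φ ⟨i, ConjClasses.mk (x⁻¹ * z)⟩ * A ⟨i, z⟩ ⟨j, y⟩ := by
    rw [Matrix.mul_apply, Fintype.sum_sigma, Fintype.sum_eq_single i fun l hl =>
      Finset.sum_eq_zero fun z _ => by rw [classCirculant_apply_ne φ x z hl.symm, zero_mul]]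
    simp only [classCirculant_apply_eq]
  rw [h1, h2]
  by_cases hij : i = j
  · subst hij
    -- Substituting `x * z⁻¹ * y` for `z` matches the sums termwise, up to a conjugation that `φ`
    -- ignores.
    rw [← Equiv.sum_comp (((Equiv.inv (G i)).trans (Equiv.mulLeft x)).trans (Equiv.mulRight y))]
    refine Finset.sum_congr rfl fun z _ => ?_
    have hconj : ConjClasses.mk ((x * z⁻¹ * y)⁻¹ * y) = ConjClasses.mk (x⁻¹ * z) :=
      ConjClasses.mk_eq_mk_iff_isConj.2 (isConj_iff.2 ⟨x⁻¹ * y, by group⟩)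
    have hz := hA.1 i (x * z⁻¹) z y
    simp only [inv_mul_cancel_right] at hz
    simp only [Equiv.trans_apply, Equiv.inv_apply, Equiv.coe_mulLeft, Equiv.coe_mulRight, hconj, hz,
      mul_comm]
  -- Here the two sides are `a` times the sums of `φ` over `G j` and over `G i`.
  · obtain ⟨a, ha⟩ := hA.2 i j hij
    simp only [ha, ← Finset.mul_sum, ← Finset.sum_mul]
    rw [mul_comm a]
    congr 1
    exact (((Equiv.inv (G j)).trans (Equiv.mulRight y)).sum_comp
      (fun z => φ ⟨j, ConjClasses.mk z⟩)).trans ((hc j).trans ((hc i).symm.trans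
        (Equiv.sum_comp (Equiv.mulLeft x⁻¹) (fun z => φ ⟨i, ConjClasses.mk z⟩)).symm))

variable [∀ i, DecidableEq (G i)]

/-- Three families of test matrices suffice: block projections kill the off-diagonal blocks, right
translations make the diagonal blocks bi-invariant, and all-ones blocks equate the sums. -/
theorem exists_classCirculant_eq {Z : Matrix (Σ i, G i) (Σ i, G i) k} (hZ : IsCirculantJoin Z)
    (h : ∀ A, IsCirculantJoin A → A * Z = Z * A) :
    ∃ φ ∈ equalClassSum k G, classCirculant k G φ = Z := by
  have hne : ∀ (i j : Fin d) (x : G i) (y : G j), i ≠ j → Z ⟨i, x⟩ ⟨j, y⟩ = 0 := by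
    intro i j x y hij
    have := congrFun₂ (h _ (isCirculantJoin_diagonal_fst (Pi.single i 1))) ⟨i, x⟩ ⟨j, y⟩
    simpa [Matrix.diagonal_mul, Matrix.mul_diagonal, hij.symm] using this
  have hright : ∀ (i : Fin d) (g x y : G i), Z ⟨i, x * g⟩ ⟨i, y * g⟩ = Z ⟨i, x⟩ ⟨i, y⟩ := by
    intro i g x y
    have := congrFun₂ (h _ (isCirculantJoin_mulRight (Pi.mulSingle i g))) ⟨i, x⟩ ⟨i, y * g⟩
    simpa [PEquiv.toMatrix_toPEquiv_mul, PEquiv.mul_toMatrix_toPEquiv] using this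
  let φ : (Σ i, ConjClasses (G i)) → k := fun C =>
    Quotient.liftOn C.2 (fun g => Z ⟨C.1, 1⟩ ⟨C.1, g⟩)
    (by
      intro a b hab
      obtain ⟨c, rfl⟩ := isConj_iff.1 hab
      -- Left translation by `c`, then right translation by `c⁻¹`, moves the entry `(1, a)` to `(1,
      -- c * a * c⁻¹)`.
      have h1 := hZ.1 C.1 c 1 (a * c⁻¹)
      have h2 := hright C.1 c 1 (a * c⁻¹)
      simp only [mul_one, one_mul, inv_mul_cancel_right] at h1 h2
      have h3 := hright C.1 c⁻¹ c (c * a)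
      have h4 := hZ.1 C.1 c 1 a
      simp only [mul_one, mul_inv_cancel] at h3 h4
      rw [h3, h4])
  have hφ : classCirculant k G φ = Z := by
    ext ⟨i, x⟩ ⟨j, y⟩
    by_cases hij : i = j
    · subst hij
      rw [classCirculant_apply_eq]
      have := hZ.1 i x 1 (x⁻¹ * y)
      rw [mul_one, mul_inv_cancel_left] at this
      exact this.symm
    · rw [classCirculant_apply_ne φ x y hij, hne i j x y hij]
  refine ⟨φ, ?_, hφ⟩
  have key : ∀ i j, ∑ g : G i, φ ⟨i, ConjClasses.mk g⟩ = ∑ g : G j, φ ⟨j, ConjClasses.mk g⟩ := by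
    intro i j
    -- One entry of the commutation relation with the `(i, j)` all-ones block compares the two sums,
    -- one of them reindexed by inversion.
    have := congrFun₂ (h _ (isCirculantJoin_of_fst (G := G)
      fun a b => if a = i ∧ b = j then (1 : k) else 0)) ⟨i, 1⟩ ⟨j, 1⟩
    rw [← hφ, Matrix.mul_apply, Matrix.mul_apply, Fintype.sum_sigma, Fintype.sum_sigma,
      Fintype.sum_eq_single j fun l hl => Finset.sum_eq_zero fun z _ => by
        simp [hl],
      Fintype.sum_eq_single i fun l hl => Finset.sum_eq_zero fun z _ => by
        simp [hl]] at this
    simp only [classCirculant_apply_eq, Matrix.of_apply, and_self, if_true, one_mul, mul_one,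
      inv_one] at this
    rw [← this]
    exact Equiv.sum_comp (Equiv.inv (G j)) (fun z => φ ⟨j, ConjClasses.mk z⟩)
  rw [mem_equalClassSum_iff]
  rcases isEmpty_or_nonempty (Fin d) with hd | ⟨⟨i⟩⟩
  · exact ⟨0, fun i => hd.elim i⟩
  · exact ⟨_, fun j => key j i⟩

variable (k G)

theorem map_center_joinAlgebra :
    (Subalgebra.toSubmodule (Subalgebra.center k (joinAlgebra k G))).map
      (joinAlgebra k G).val.toLinearMap = (equalClassSum k G).map (classCirculant k G) := by
  ext Z
  simp only [Submodule.mem_map, Subalgebra.mem_toSubmodule, Subalgebra.mem_center_iff]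
  constructor
  · rintro ⟨⟨Z, hZ⟩, h, rfl⟩
    exact exists_classCirculant_eq hZ fun A hA => congrArg Subtype.val (h ⟨A, hA⟩)
  · rintro ⟨φ, hφ, rfl⟩
    exact ⟨⟨_, isCirculantJoin_classCirculant φ⟩,
      fun A => Subtype.ext (commute_classCirculant hφ A.2), rfl⟩

theorem finrank_center_joinAlgebra :
    Module.finrank k (Subalgebra.center k (joinAlgebra k G)) =
      Module.finrank k (equalClassSum k G) := by
  have h1 := (Submodule.equivMapOfInjective (joinAlgebra k G).val.toLinearMap
    Subtype.val_injective (Subalgebra.toSubmodule (Subalgebra.center k (joinAlgebra k G)))).finrank_eq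
  rw [map_center_joinAlgebra] at h1
  exact h1.trans
    (Submodule.equivMapOfInjective _ classCirculant_injective (equalClassSum k G)).finrank_eq.symm

end Center

/-- A `p` dividing one order divides the product, so coprimality would give `p = 1`, which is not
the characteristic of a field. -/
theorem natCast_card_ne_zero {k : Type*} [Field k] (p : ℕ) [CharP k p] {d : ℕ}
    (G : Fin d → Type*) [∀ i, Group (G i)] [∀ i, Finite (G i)]
    (hp : p = 0 ∨ Nat.Coprime p (∏ i, Nat.card (G i))) (i : Fin d) :
    (Nat.card (G i) : k) ≠ 0 := by
  rw [Ne, CharP.cast_eq_zero_iff k p]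
  intro h
  rcases hp with rfl | hp
  · exact Nat.card_pos.ne' (Nat.eq_zero_of_zero_dvd h)
  · have h1 : p = 1 :=
      Nat.Coprime.eq_one_of_dvd hp (h.trans (Finset.dvd_prod_of_mem _ (Finset.mem_univ i)))
    exact CharP.char_ne_one k p h1

theorem mainTheorem6 {k : Type u} [Field k] [IsAlgClosed k] (p : ℕ) [CharP k p]
    {d : ℕ} (hd : 1 ≤ d) (G : Fin d → Type v) [∀ i, Group (G i)]
    [∀ i, Fintype (G i)] [∀ i, DecidableEq (G i)]
    (hp : p = 0 ∨ Nat.Coprime p (∏ i, Nat.card (G i))) :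
    Finite (SimpleModuleClasses (joinAlgebra k G)) ∧
      (Nat.card (SimpleModuleClasses (joinAlgebra k G)) : ℤ) =
        (∑ i, (Nat.card (ConjClasses (G i)) : ℤ)) - d + 1 := by
  have := isSemisimpleRing_joinAlgebra k G (natCast_card_ne_zero p G hp)
  refine ⟨finite_simpleModuleClasses _, ?_⟩
  have h := finrank_equalClassSum k G hd
  rw [card_simpleModuleClasses k, finrank_center_joinAlgebra]
  have h' := congrArg (Nat.cast : ℕ → ℤ) h
  push_cast at h'
  linarith
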